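/- Let $p,q$ be strictly positive differentiable probability densities on $\mathbb{R}^D$ with $q(x)\to 0$ as $\|x\|\to\infty$, and let $s_p=\nabla\log p$, $s_q=\nabla\log q$ be their scores; for a unit vector $r\in\mathbb{S}^{D-1}$ put $s_p^r=s_p^Tr$, $s_q^r=s_q^Tr$. Assume that $s_p^r-s_q^r$ belongs to $L^1(q\,dx)$ and to $L^2(q\,dx)$ for every $r\in\mathbb{S}^{D-1}$. For all $r,g\in\mathbb{S}^{D-1}$ let $\mathcal{H}_{rg}$ be a reproducing kernel Hilbert space of real functions on $\mathbb{R}$ with kernel $k_{rg}$ such that (i) $k_{rg}$ is $C_0$-universal, i.e. $\mathcal{H}_{rg}\subset C_0(\mathbb{R})$ and $\mathcal{H}_{rg}$ is dense in $C_0(\mathbb{R})$ for the supremum norm; (ii) the kernel $k(x,x')=k_{rg}(x^Tg,x'^Tg)$ on $\mathbb{R}^D$ is in the Stein class of $q$: it has continuous second order partial derivatives and, for each fixed $x$, the functions $f=k(x,\cdot)$ and $f=k(\cdot,x)$ are continuously differentiable with $\nabla(fq)$ Lebesgue integrable and $\int_{\mathbb{R}^D}\nabla(fq)\,dx=0$;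 (iii) $\sup_x k_{rg}(x^Tg,x^Tg)<\infty$; (iv) $\mathbb{E}_q[h_{p,r,g}(x,x)]<\infty$, where $$h_{p,r,g}(x,y)=s_p^r(x)s_p^r(y)\,k_{rg}(s,t)+r^Tg\,s_p^r(y)\,\partial_sk_{rg}(s,t)+r^Tg\,s_p^r(x)\,\partial_tk_{rg}(s,t)+(r^Tg)^2\,\partial_s\partial_tk_{rg}(s,t)$$ with $s=x^Tg$ and $t=y^Tg$. Put $$D^2_{rg}(q,p)=\Big(\sup_{f\in\mathcal{H}_{rg},\ \|f\|\le1}\mathbb{E}_{x\sim q}\big[s_p^r(x)f(x^Tg)+r^Tg\,f'(x^Tg)\big]\Big)^2 .$$ Let $O_r$ be an orthonormal basis of $\mathbb{R}^D$ and let $p_g$ be the uniform probability distribution on $\mathbb{S}^{D-1}$. Assume that $g\mapsto D^2_{rg}(q,p)$ is $p_g$-measurable for each $r\in O_r$, so that $$SK_o(q,p)=\sum_{r\in O_r}\int_{\mathbb{S}^{D-1}}D^2_{rg}(q,p)\,dp_g(g)\in[0,\infty]$$ is defined. Then $SK_o(q,p)=0$ if and only if $p=q$ almost everywhere. -/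

import Mathlib

open MeasureTheory Filter Topology
open scoped ENNReal Gradient ZeroAtInfty

noncomputable section

/-- `ℝ^D` with its Euclidean norm. -/
abbrev Euc (D : ℕ) : Type := EuclideanSpace ℝ (Fin D)

/-- The unit sphere `𝕊^{D-1}` of `ℝ^D`. -/
abbrev USphere (D : ℕ) : Type := Metric.sphere (0 : Euc D) 1

/-- `q` is a continuous, differentiable probability density supported on all of `ℝ^D`. -/
structure IsDiffPosDensity {D : ℕ} (q : Euc D → ℝ) : Prop where
  pos : ∀ x, 0 < q x
  differentiable : Differentiable ℝ q
  integrable : Integrable q volume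
  integral_eq_one : ∫ x, q x = 1

/-- The probability measure `q(x) dx`. -/
def densityMeasure {D : ℕ} (q : Euc D → ℝ) : Measure (Euc D) :=
  volume.withDensity (fun x => ENNReal.ofReal (q x))

/-- The score `s_p(x) = ∇ log p(x)`. -/
def score {D : ℕ} (p : Euc D → ℝ) (x : Euc D) : Euc D :=
  ∇ (fun y => Real.log (p y)) x

/-- The projected score `s_p^r(x) = s_p(x)ᵀ r`. -/
def projScore {D : ℕ} (p : Euc D → ℝ) (r : USphere D) (x : Euc D) : ℝ :=
  inner ℝ (score p x) (r : Euc D)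

/-- `f` is in the Stein class of `q`: it is smooth (continuously differentiable) and
`∫ ∇(f q) dx = 0`, the integral being an absolutely convergent one. -/
def InSteinClass {D : ℕ} (q f : Euc D → ℝ) : Prop :=
  ContDiff ℝ 1 f ∧
  Integrable (fun x => ∇ (fun y => f y * q y) x) volume ∧
  ∫ x, ∇ (fun y => f y * q y) x = 0

/-- A kernel `K` on `ℝ^D` is in the Stein class of `q`: it has continuous second order partial
derivatives, and all `K(x, ·)` and `K(·, x)` are in the Stein class of `q`. -/
def KernelInSteinClass {D : ℕ} (q : Euc D → ℝ) (K : Euc D → Euc D → ℝ) : Prop :=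
  ContDiff ℝ 2 (fun z : Euc D × Euc D => K z.1 z.2) ∧
  ∀ x, InSteinClass q (fun y => K x y) ∧ InSteinClass q (fun y => K y x)

/-- The scalar reproducing kernel `k(s, t)` of an RKHS of real functions on `ℝ`. -/
def scalarKernel (H : Type*) [NormedAddCommGroup H] [InnerProductSpace ℝ H] [CompleteSpace H]
    [RKHS ℝ H ℝ ℝ] (s t : ℝ) : ℝ :=
  RKHS.kernel H s t 1

/-- The kernel of `H` is `C₀`-universal: `H` consists of continuous functions vanishing at
infinity, and is dense in `C₀(ℝ)` for the supremum norm. -/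
def IsC0Universal (H : Type*) [NormedAddCommGroup H] [InnerProductSpace ℝ H]
    [RKHS ℝ H ℝ ℝ] : Prop :=
  (∀ f : H, ∃ F : C₀(ℝ, ℝ), ∀ t, F t = f t) ∧
  Dense {F : C₀(ℝ, ℝ) | ∃ f : H, ∀ t, F t = f t}

/-- The function `h_{p,r,g}(x, y)` built from a scalar kernel `k`. -/
def steinKernel {D : ℕ} (p : Euc D → ℝ) (r g : USphere D) (k : ℝ → ℝ → ℝ) (x y : Euc D) : ℝ :=
  let s : ℝ := inner ℝ x (g : Euc D)
  let t : ℝ := inner ℝ y (g : Euc D)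
  let c : ℝ := inner ℝ (r : Euc D) (g : Euc D)
  projScore p r x * k s t * projScore p r y
    + c * projScore p r y * deriv (fun a => k a t) s
    + c * projScore p r x * deriv (fun b => k s b) t
    + c ^ 2 * deriv (fun b => deriv (fun a => k a b) s) t

/-- `D²_{rg}(q, p)`: the square of the supremum, over `f` in the unit ball of `H`, of
`E_q[s_p^r(x) f(xᵀg) + (rᵀg) f'(xᵀg)]`. -/
def discSq {D : ℕ} (q p : Euc D → ℝ) (r g : USphere D) (H : Type*) [NormedAddCommGroup H]
    [InnerProductSpace ℝ H] [RKHS ℝ H ℝ ℝ] : ℝ :=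
  (⨆ f : Metric.closedBall (0 : H) 1,
    ∫ x, (projScore p r x * (f : H) (inner ℝ x (g : Euc D))
      + inner ℝ (r : Euc D) (g : Euc D) * deriv (⇑(f : H)) (inner ℝ x (g : Euc D)))
      ∂(densityMeasure q)) ^ 2

/-- The uniform probability distribution on the unit sphere. -/
def sphereUniform (D : ℕ) : Measure (USphere D) :=
  ((volume : Measure (Euc D)).toSphere Set.univ)⁻¹ • (volume : Measure (Euc D)).toSphere

/-- A member of an orthonormal basis, as a point of the unit sphere. -/
def basisDir {D : ℕ} (O : OrthonormalBasis (Fin D) ℝ (Euc D)) (i : Fin D) : USphere D :=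
  ⟨O i, by simp⟩

/-- `SK_o(q, p)`: the sum over the basis of the average over `g` of `D²_{rg}(q, p)`, as an element
of `[0, ∞]`. -/
def SKo {D : ℕ} (O : OrthonormalBasis (Fin D) ℝ (Euc D)) (q p : Euc D → ℝ)
    (H : USphere D → USphere D → Type*) [∀ r g, NormedAddCommGroup (H r g)]
    [∀ r g, InnerProductSpace ℝ (H r g)] [∀ r g, RKHS ℝ (H r g) ℝ ℝ] : ℝ≥0∞ :=
  ∑ i, ∫⁻ g, ENNReal.ofReal (discSq q p (basisDir O i) g (H (basisDir O i) g))
    ∂(sphereUniform D)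

end

/-! Write `w = s_p^r - s_q^r`. For `f` in the Hilbert space, Stein's identity for `q` turns the
expected Stein operator of `p` into `E_q[w(x) f(xᵀg)]` (`integral_steinOp_eq`). So `D²_{rg} = 0`
says precisely that `w` is orthogonal in `q dx` to all ridge functions along `g` with profile in the
space (`discSq_eq_zero_iff`). If `SK_o = 0`, this holds for every basis vector `r` and almost every
`g`, hence for a dense set of `g`. Universality enlarges the profiles to all of `C₀(ℝ)`, and a
Cramér–Wold argument gives `w = 0` almost everywhere (`ae_eq_zero_of_integral_ridge_eq_zero`). Then
`log p - log q` is differentiable with gradient zero almost everywhere, hence constant, and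
normalisation forces `p = q`. The converse is immediate, since `w = 0` when `p = q`.

The Stein class hypothesis concerns kernel sections only. To reach every `f`, note that a `C²`
kernel makes `t ↦ k(t, ·)` differentiable into the Hilbert space, so that `h_{p,r,g}(x,x)` is the
squared norm of the representer of the Stein operator at `x`. With `k` bounded on the diagonal and
`w` in `L¹(q)`, the expected Stein operator of `q` is then a bounded functional; it vanishes on the
sections, whose span is dense. -/

/-! ### Differentiability of Hilbert space curves with a `C²` Gram kernel. -/

/-- Second differences of a `C²` function of two real variables. -/
theorem exists_secondDifference_bound {k : ℝ × ℝ → ℝ} (hk : ContDiff ℝ 2 k) (s : ℝ) :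
    ∃ M : ℝ, ∀ ε > 0, ∃ δ > 0, ∀ h h' : ℝ, |h| < δ → |h'| < δ →
      |k (s + h, s + h') - k (s, s + h') - k (s + h, s) + k (s, s) - M * h * h'|
        ≤ ε * |h| * |h'| := by
  set k₁ : ℝ × ℝ → ℝ := fun z => fderiv ℝ k z (1, 0) with hk₁
  have hk₁C : ContDiff ℝ 1 k₁ := (hk.fderiv_right (m := 1) le_rfl).clm_apply contDiff_const
  set m : ℝ × ℝ → ℝ := fun z => fderiv ℝ k₁ z (0, 1) with hm
  have hmC : Continuous m :=
    ((hk₁C.fderiv_right (m := 0) le_rfl).clm_apply contDiff_const).continuous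
  have hd₁ : ∀ a b, HasDerivAt (fun a => k (a, b)) (k₁ (a, b)) a := fun a b =>
    (hk.differentiable (by norm_num) (a, b)).hasFDerivAt.comp_hasDerivAt a
      ((hasDerivAt_id a).prodMk (hasDerivAt_const a b))
  have hd₂ : ∀ a b, HasDerivAt (fun b => k₁ (a, b)) (m (a, b)) b := fun a b =>
    (hk₁C.differentiable (by norm_num) (a, b)).hasFDerivAt.comp_hasDerivAt b
      ((hasDerivAt_const b a).prodMk (hasDerivAt_id b))
  -- The constant is the mixed partial derivative at `(s, s)`; the mean value inequality is applied
  -- in the second variable, then in the first.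
  refine ⟨m (s, s), fun ε hε => ?_⟩
  obtain ⟨δ, hδ, hball⟩ := Metric.continuousAt_iff.1 (hmC.continuousAt (x := (s, s))) ε hε
  refine ⟨δ, hδ, fun h h' hh hh' => ?_⟩
  have hbox : ∀ a ∈ Metric.ball s δ, ∀ b ∈ Metric.ball s δ, ‖m (a, b) - m (s, s)‖ ≤ ε := by
    intro a ha b hb
    refine (hball ?_).le
    rw [Prod.dist_eq]
    exact max_lt ha hb
  have hs : s ∈ Metric.ball s δ := Metric.mem_ball_self hδ
  have hsh : s + h ∈ Metric.ball s δ := by simpa [Metric.mem_ball, Real.dist_eq] using hh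
  have hsh' : s + h' ∈ Metric.ball s δ := by simpa [Metric.mem_ball, Real.dist_eq] using hh'
  have h1 : ∀ a ∈ Metric.ball s δ,
      ‖k₁ (a, s + h') - k₁ (a, s) - m (s, s) * h'‖ ≤ ε * |h'| := by
    intro a ha
    have := (convex_ball s δ).norm_image_sub_le_of_norm_hasDerivWithin_le
      (f := fun b => k₁ (a, b) - m (s, s) * b) (f' := fun b => m (a, b) - m (s, s))
      (fun b _ => ((hd₂ a b).sub
        (by simpa using (hasDerivAt_id b).const_mul (m (s, s)))).hasDerivWithinAt)
      (fun b hb => hbox a ha b hb) hs hsh'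
    rw [add_sub_cancel_left, Real.norm_eq_abs h'] at this
    rw [show k₁ (a, s + h') - k₁ (a, s) - m (s, s) * h' =
      k₁ (a, s + h') - m (s, s) * (s + h') - (k₁ (a, s) - m (s, s) * s) by ring]
    exact this
  have := (convex_ball s δ).norm_image_sub_le_of_norm_hasDerivWithin_le
      (f := fun a => k (a, s + h') - k (a, s) - m (s, s) * h' * a)
      (f' := fun a => k₁ (a, s + h') - k₁ (a, s) - m (s, s) * h')
      (fun a _ => (((hd₁ a (s + h')).sub (hd₁ a s)).sub
        (by simpa using (hasDerivAt_id a).const_mul (m (s, s) * h'))).hasDerivWithinAt)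
      (fun a ha => h1 a ha) hs hsh
  rw [add_sub_cancel_left, Real.norm_eq_abs h] at this
  rw [Real.norm_eq_abs] at this
  calc _ = _ := congrArg abs (by ring)
    _ ≤ _ := this
    _ = _ := by ring

/-- A curve in a Hilbert space whose Gram kernel is `C²` is differentiable. -/
theorem differentiable_of_contDiff_inner {H : Type*} [NormedAddCommGroup H]
    [InnerProductSpace ℝ H] [CompleteSpace H] {κ : ℝ → H}
    (hk : ContDiff ℝ 2 fun z : ℝ × ℝ => inner ℝ (κ z.1) (κ z.2)) : Differentiable ℝ κ := by
  intro s
  obtain ⟨M, hM⟩ := exists_secondDifference_bound hk s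
  set d : ℝ → H := fun h => h⁻¹ • (κ (s + h) - κ s) with hd
  -- Inner products of difference quotients are normalised second differences of the kernel, so they
  -- all approach the same `M`.
  have hinner : ∀ ε > 0, ∃ δ > 0, ∀ h h' : ℝ, h ≠ 0 → h' ≠ 0 → |h| < δ → |h'| < δ →
      |inner ℝ (d h) (d h') - M| ≤ ε := by
    intro ε hε
    obtain ⟨δ, hδ, hb⟩ := hM ε hε
    refine ⟨δ, hδ, fun h h' h0 h0' hh hh' => ?_⟩
    have hpos : 0 < |h| * |h'| := by positivity
    refine le_of_mul_le_mul_right ?_ hpos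
    rw [← abs_mul h, ← abs_mul, abs_mul h]
    refine le_of_eq_of_le (congrArg abs ?_) ((hb h h' hh hh').trans_eq (mul_assoc _ _ _))
    simp only [hd, inner_smul_left, inner_smul_right, inner_sub_left, inner_sub_right,
      RCLike.conj_to_real]
    field_simp
    ring
  have hC : Cauchy (map d (𝓝[≠] 0)) := by
    refine Metric.cauchy_iff.2 ⟨inferInstance, fun ε hε => ?_⟩
    -- In `‖d h‖² - 2⟪d h, d h'⟫ + ‖d h'‖²` the `M`s cancel and the error is at most `4 ε² / 5 <
    -- ε²`.
    obtain ⟨δ, hδ, hb⟩ := hinner (ε ^ 2 / 5) (by positivity)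
    refine ⟨d '' (Metric.ball 0 δ ∩ {0}ᶜ), image_mem_map
      (inter_mem (mem_nhdsWithin_of_mem_nhds (Metric.ball_mem_nhds 0 hδ))
        self_mem_nhdsWithin), ?_⟩
    rintro _ ⟨h, ⟨hh, h0⟩, rfl⟩ _ ⟨h', ⟨hh', h0'⟩, rfl⟩
    have hh : |h| < δ := by simpa using hh
    have hh' : |h'| < δ := by simpa using hh'
    have e1 := abs_le.1 (hb h h h0 h0 hh hh)
    have e2 := abs_le.1 (hb h h' h0 h0' hh hh')
    have e3 := abs_le.1 (hb h' h' h0' h0' hh' hh')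
    rw [dist_eq_norm]
    refine lt_of_pow_lt_pow_left₀ 2 hε.le ?_
    rw [@norm_sub_sq_real, ← real_inner_self_eq_norm_sq, ← real_inner_self_eq_norm_sq]
    have : 0 < ε ^ 2 := by positivity
    linarith [e1.2, e2.1, e3.2]
  obtain ⟨d', hd'⟩ := CompleteSpace.complete hC
  exact (hasDerivAt_iff_tendsto_slope_zero.2 hd').differentiableAt

/-! ### Functions whose derivative vanishes almost everywhere. -/

/-- An everywhere differentiable function on the line with a.e. vanishing derivative is
constant. -/
theorem eq_of_deriv_ae_eq_zero {u : ℝ → ℝ} (hu : Differentiable ℝ u)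
    (h0 : ∀ᵐ t, deriv u t = 0) (a b : ℝ) : u b = u a := by
  -- Differentiability at every point is essential: the fundamental theorem then needs only an
  -- integrable derivative.
  have := intervalIntegral.integral_eq_sub_of_hasDerivAt (a := a) (b := b)
    (fun t _ => (hu t).hasDerivAt)
    ((intervalIntegrable_const (c := (0 : ℝ))).congr_ae
      (ae_restrict_of_ae (h0.mono fun t ht => ht.symm)))
  rw [intervalIntegral.integral_congr_ae (g := fun _ => 0) (h0.mono fun t ht _ => ht)] at this
  simp at this
  linarith

/-- An everywhere differentiable function with a.e. vanishing derivative is constant. -/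
theorem eq_of_fderiv_ae_eq_zero {E : Type*} [NormedAddCommGroup E] [NormedSpace ℝ E]
    [FiniteDimensional ℝ E] [MeasurableSpace E] [BorelSpace E] (μ : Measure E)
    [μ.IsAddHaarMeasure] {u : E → ℝ}
    (hu : Differentiable ℝ u) (h0 : ∀ᵐ x ∂μ, fderiv ℝ u x = 0) (x y : E) : u x = u y := by
  have key : ∀ v : E, ∀ x, u (x + v) = u x := by
    intro v
    have hmeas : MeasurableSet {z : E × ℝ | fderiv ℝ u (z.1 + z.2 • v) = 0} :=
      (measurable_fderiv ℝ u).comp (by fun_prop : Measurable fun z : E × ℝ => z.1 + z.2 • v)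
        (measurableSet_singleton 0)
    -- By translation invariance and Fubini, almost every line parallel to `v` meets the exceptional
    -- set in a null set.
    have hprod : ∀ᵐ x ∂μ, ∀ᵐ t : ℝ, fderiv ℝ u (x + t • v) = 0 := by
      have h1 : ∀ᵐ t : ℝ, ∀ᵐ x ∂μ, fderiv ℝ u (x + t • v) = 0 :=
        Eventually.of_forall fun t => (quasiMeasurePreserving_add_right μ (t • v)).ae h0
      exact (Measure.ae_ae_comm hmeas).2 h1
    have hae : (fun x => u (x + v)) =ᵐ[μ] u := by
      filter_upwards [hprod] with x hx
      have hline : ∀ t : ℝ, HasDerivAt (fun t : ℝ => u (x + t • v))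
          (fderiv ℝ u (x + t • v) v) t := fun t =>
        (hu (x + t • v)).hasFDerivAt.comp_hasDerivAt t
          (by simpa using ((hasDerivAt_id t).smul_const v).const_add x)
      have := eq_of_deriv_ae_eq_zero (fun t => (hline t).differentiableAt)
        (hx.mono fun t ht => by rw [(hline t).deriv, ht]; rfl) 0 1
      simpa using this
    have hc : Continuous u := hu.continuous
    exact congrFun ((by fun_prop : Continuous fun x => u (x + v)).ae_eq_iff_eq μ hc |>.1 hae)
  simpa using key (x - y) y

/-! ### A Cramér–Wold theorem for ridge functions. -/

/-- The characteristic function along a line is that of the projection to the line. -/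
theorem charFun_smul_eq_charFun_map_inner {E : Type*} [NormedAddCommGroup E]
    [InnerProductSpace ℝ E] [MeasurableSpace E] [BorelSpace E] (μ : Measure E) (g : E) (t : ℝ) :
    charFun μ (t • g) = charFun (μ.map fun x => inner ℝ x g) t := by
  have hm : Measurable fun x : E => inner ℝ x g := Continuous.measurable (by fun_prop)
  rw [charFun_apply, charFun_apply_real, integral_map hm.aemeasurable (by fun_prop)]
  simp_rw [inner_smul_right, Complex.ofReal_mul]

/-- If the integrals of an integrable function against all ridge functions with a `C₀` profile
vanish, for a dense set of directions, then the function vanishes almost everywhere. -/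
theorem ae_eq_zero_of_integral_ridge_eq_zero {E : Type*} [NormedAddCommGroup E]
    [InnerProductSpace ℝ E] [FiniteDimensional ℝ E] [MeasurableSpace E] [BorelSpace E]
    (μ : Measure E) [IsFiniteMeasure μ] [Nonempty (Metric.sphere (0 : E) 1)] {φ : E → ℝ}
    (hφ : Integrable φ μ) {G : Set (Metric.sphere (0 : E) 1)} (hG : Dense G)
    (h : ∀ g ∈ G, ∀ F : C₀(ℝ, ℝ), ∫ x, φ x * F (inner ℝ x (g : E)) ∂μ = 0) : φ =ᵐ[μ] 0 := by
  have hfin : ∀ {ψ : E → ℝ}, Integrable ψ μ →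
      IsFiniteMeasure (μ.withDensity fun x => ENNReal.ofReal (ψ x)) :=
    fun hψ => isFiniteMeasure_withDensity_ofReal hψ.2
  have := hfin hφ
  have := hfin hφ.neg
  -- The positive and negative parts of `φ μ` are finite measures with the same projection along
  -- each `g ∈ G`.
  have hmap : ∀ g ∈ G,
      (μ.withDensity fun x => ENNReal.ofReal (φ x)).map (fun x => inner ℝ x (g : E)) =
      (μ.withDensity fun x => ENNReal.ofReal ((-φ) x)).map (fun x => inner ℝ x (g : E)) := by
    intro g hg
    have hc : Continuous fun x : E => inner ℝ x (g : E) := by fun_prop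
    refine Measure.ext_of_integral_eq_on_compactlySupported fun f => ?_
    obtain ⟨F, hF⟩ : ∃ F : C₀(ℝ, ℝ), ∀ t, f t = F t :=
      ⟨⟨f.toContinuousMap, f.hasCompactSupport.is_zero_at_infty⟩, fun _ => rfl⟩
    have hFc : Continuous fun x : E => F (inner ℝ x (g : E)) := (map_continuous F).comp hc
    have hint : ∀ {ψ : E → ℝ}, Integrable ψ μ →
        Integrable (fun x => (ENNReal.ofReal (ψ x)).toReal * F (inner ℝ x (g : E))) μ := by
      intro ψ hψ
      refine Integrable.mul_bdd (c := ‖F.toBCF‖) ?_ hFc.aestronglyMeasurable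
        (Eventually.of_forall fun x => F.toBCF.norm_coe_le_norm _)
      simpa only [ENNReal.toReal_ofReal'] using hψ.pos_part
    simp_rw [hF]
    rw [integral_map hc.aemeasurable (map_continuous F).aestronglyMeasurable,
      integral_map hc.aemeasurable (map_continuous F).aestronglyMeasurable,
      integral_withDensity_eq_integral_toReal_smul₀ hφ.aemeasurable.ennreal_ofReal (by simp),
      integral_withDensity_eq_integral_toReal_smul₀ hφ.neg.aemeasurable.ennreal_ofReal (by simp)]
    simp_rw [smul_eq_mul]
    rw [← sub_eq_zero, ← integral_sub (hint hφ) (hint hφ.neg), ← h g hg F]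
    congr 1 with x
    rw [← sub_mul]
    simp only [ENNReal.toReal_ofReal', Pi.neg_apply]
    rw [max_zero_sub_max_neg_zero_eq_self]
  -- Continuity of characteristic functions passes from the dense set `G` to all directions.
  have hchar : ∀ g : Metric.sphere (0 : E) 1, ∀ t : ℝ,
      charFun (μ.withDensity fun x => ENNReal.ofReal (φ x)) (t • (g : E)) =
      charFun (μ.withDensity fun x => ENNReal.ofReal ((-φ) x)) (t • (g : E)) := by
    intro g t
    have hcont : ∀ (ν : Measure E) [IsFiniteMeasure ν],
        Continuous fun g : Metric.sphere (0 : E) 1 => charFun ν (t • (g : E)) := fun ν _ =>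
      continuous_charFun.comp (by fun_prop)
    refine congrFun (Continuous.ext_on hG (hcont _) (hcont _) fun g hg => ?_) g
    simp only [charFun_smul_eq_charFun_map_inner, hmap g hg]
  have heq : (μ.withDensity fun x => ENNReal.ofReal (φ x)) =
      μ.withDensity fun x => ENNReal.ofReal ((-φ) x) := by
    refine Measure.ext_of_charFun (funext fun v => ?_)
    by_cases hv : v = 0
    · simpa [hv] using hchar (Classical.arbitrary _) 0
    · have h1 := norm_ne_zero_iff.2 hv
      simpa [smul_smul, h1] using hchar ⟨‖v‖⁻¹ • v, by simp [norm_smul, h1]⟩ ‖v‖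
  rw [withDensity_eq_iff_of_sigmaFinite hφ.aemeasurable.ennreal_ofReal
    hφ.neg.aemeasurable.ennreal_ofReal] at heq
  filter_upwards [heq] with x hx
  have := congrArg ENNReal.toReal hx
  simp only [ENNReal.toReal_ofReal', Pi.neg_apply] at this
  have e := max_zero_sub_max_neg_zero_eq_self (φ x)
  rw [this, sub_self] at e
  exact e.symm

/-! ### Evaluation and differentiation in a reproducing kernel Hilbert space. -/

section ReproducingKernel

variable {H : Type*} [NormedAddCommGroup H] [InnerProductSpace ℝ H] [CompleteSpace H]
  [RKHS ℝ H ℝ ℝ]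

theorem RKHS.apply_eq_inner_kerFun (f : H) (t : ℝ) : f t = inner ℝ (RKHS.kerFun H t 1) f := by
  simp

variable (H) in
theorem scalarKernel_eq_inner (s t : ℝ) :
    scalarKernel H s t = inner ℝ (RKHS.kerFun H s 1) (RKHS.kerFun H t 1) := by
  rw [scalarKernel, ← RKHS.kerFun_apply, RKHS.apply_eq_inner_kerFun]

theorem RKHS.hasDerivAt_of_differentiable_kerFun
    (hκ : Differentiable ℝ fun t => RKHS.kerFun H t (1 : ℝ)) (f : H) (t : ℝ) :
    HasDerivAt f (inner ℝ (deriv (fun t => RKHS.kerFun H t (1 : ℝ)) t) f) t := by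
  have := (hκ t).hasDerivAt.inner ℝ (hasDerivAt_const t f)
  simp only [inner_zero_right, zero_add, ← RKHS.apply_eq_inner_kerFun] at this
  exact this

end ReproducingKernel

/-! ### Densities and scores. -/

variable {D : ℕ}

theorem IsDiffPosDensity.isProbabilityMeasure {q : Euc D → ℝ} (hq : IsDiffPosDensity q) :
    IsProbabilityMeasure (densityMeasure q) :=
  ⟨by rw [densityMeasure, withDensity_apply _ MeasurableSet.univ, setLIntegral_univ,
    ← ofReal_integral_eq_lintegral_ofReal hq.integrable
      (Eventually.of_forall fun x => (hq.pos x).le), hq.integral_eq_one, ENNReal.ofReal_one]⟩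

theorem IsDiffPosDensity.measurable_ofReal {q : Euc D → ℝ} (hq : IsDiffPosDensity q) :
    Measurable fun x => ENNReal.ofReal (q x) :=
  hq.differentiable.continuous.measurable.ennreal_ofReal

theorem IsDiffPosDensity.integral_densityMeasure {q : Euc D → ℝ} (hq : IsDiffPosDensity q)
    (f : Euc D → ℝ) : ∫ x, f x ∂(densityMeasure q) = ∫ x, q x * f x := by
  rw [densityMeasure, integral_withDensity_eq_integral_toReal_smul hq.measurable_ofReal
    (Eventually.of_forall fun _ => ENNReal.ofReal_lt_top)]
  simp_rw [ENNReal.toReal_ofReal (hq.pos _).le, smul_eq_mul]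

theorem IsDiffPosDensity.ae_densityMeasure {q : Euc D → ℝ} (hq : IsDiffPosDensity q)
    {P : Euc D → Prop} : (∀ᵐ x ∂(densityMeasure q), P x) ↔ ∀ᵐ x, P x := by
  rw [densityMeasure, ae_withDensity_iff hq.measurable_ofReal]
  simp [hq.pos]

theorem IsDiffPosDensity.differentiable_log {p : Euc D → ℝ} (hp : IsDiffPosDensity p) :
    Differentiable ℝ fun y => Real.log (p y) :=
  hp.differentiable.log fun x => (hp.pos x).ne'

theorem projScore_eq_fderiv_log (p : Euc D → ℝ) (r : USphere D) (x : Euc D) :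
    projScore p r x = fderiv ℝ (fun y => Real.log (p y)) x r := by
  rw [projScore, score, gradient, InnerProductSpace.toDual_symm_apply]

theorem IsDiffPosDensity.mul_projScore {p : Euc D → ℝ} (hp : IsDiffPosDensity p)
    (r : USphere D) (x : Euc D) : p x * projScore p r x = fderiv ℝ p x r := by
  rw [projScore_eq_fderiv_log, fderiv.log (hp.differentiable x) (hp.pos x).ne']
  simp [(hp.pos x).ne']

theorem measurable_projScore (p : Euc D → ℝ) (r : USphere D) : Measurable (projScore p r) := by
  simp_rw [funext (projScore_eq_fderiv_log p r)]
  exact measurable_fderiv_apply_const ℝ _ _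

/-! ### The Stein operator and Stein's identity. -/

/-- The Stein operator in the directions `r`, `g`, applied to a function on the line. -/
noncomputable def steinOp (p : Euc D → ℝ) (r g : USphere D) (f : ℝ → ℝ) (x : Euc D) : ℝ :=
  projScore p r x * f (inner ℝ x (g : Euc D))
    + inner ℝ (r : Euc D) (g : Euc D) * deriv f (inner ℝ x (g : Euc D))

section SteinOp

variable {p q : Euc D → ℝ} {r g : USphere D} {H : Type*} [NormedAddCommGroup H]
  [InnerProductSpace ℝ H] [CompleteSpace H] [RKHS ℝ H ℝ ℝ]

theorem differentiable_kerFun_of_kernelInSteinClass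
    (h : KernelInSteinClass q fun x y =>
      scalarKernel H (inner ℝ x (g : Euc D)) (inner ℝ y (g : Euc D))) :
    Differentiable ℝ fun t => RKHS.kerFun H t (1 : ℝ) := by
  refine differentiable_of_contDiff_inner ?_
  -- Since `g` is a unit vector, restricting the kernel on `ℝ^D` to the line `ℝ g` recovers the
  -- scalar kernel.
  have hc : ContDiff ℝ 2 fun z : ℝ × ℝ => (z.1 • (g : Euc D), z.2 • (g : Euc D)) := by fun_prop
  have := h.1.comp hc
  simpa [Function.comp_def, inner_smul_left, scalarKernel_eq_inner,
    -RKHS.kerFun_inner, -RKHS.inner_kerFun] using this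

theorem measurable_steinOp (p : Euc D → ℝ) (r g : USphere D) {f : ℝ → ℝ} (hf : Continuous f) :
    Measurable (steinOp p r g f) := by
  have hi : Continuous fun x : Euc D => inner ℝ x (g : Euc D) := by fun_prop
  exact ((measurable_projScore p r).mul (hf.comp hi).measurable).add
    (((measurable_deriv f).comp hi.measurable).const_mul _)

/-- The Stein kernel on the diagonal bounds the Stein operator. -/
theorem abs_steinOp_le (hκ : Differentiable ℝ fun t => RKHS.kerFun H t (1 : ℝ))
    (p : Euc D → ℝ) (r g : USphere D) (f : H) (x : Euc D) :
    |steinOp p r g f x| ≤ √(steinKernel p r g (scalarKernel H) x x) * ‖f‖ := by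
  set κ : ℝ → H := fun t => RKHS.kerFun H t 1 with hκdef
  set s : ℝ := inner ℝ x (g : Euc D) with hs
  set c : ℝ := inner ℝ (r : Euc D) (g : Euc D) with hc
  -- `ξ` represents `f ↦ steinOp p r g f x`, and its squared norm is the Stein kernel at `(x, x)`;
  -- Cauchy–Schwarz concludes.
  set ξ : H := projScore p r x • κ s + c • deriv κ s with hξ
  have h1 : steinOp p r g f x = inner ℝ ξ f := by
    rw [steinOp, (RKHS.hasDerivAt_of_differentiable_kerFun hκ f _).deriv, hξ, inner_add_left,
      real_inner_smul_left, real_inner_smul_left, RKHS.apply_eq_inner_kerFun f]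
  have hd₁ : ∀ a b, deriv (fun a => scalarKernel H a b) a = inner ℝ (deriv κ a) (κ b) := by
    intro a b
    simp_rw [scalarKernel_eq_inner]
    have := (hκ a).hasDerivAt.inner ℝ (hasDerivAt_const a (κ b))
    simp only [inner_zero_right, zero_add] at this
    exact this.deriv
  have hd₂ : ∀ (v : H) b, deriv (fun b => inner ℝ v (κ b)) b = inner ℝ v (deriv κ b) := by
    intro v b
    simpa using ((hasDerivAt_const b v).inner ℝ (hκ b).hasDerivAt).deriv
  have h2 : steinKernel p r g (scalarKernel H) x x = ‖ξ‖ ^ 2 := by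
    rw [← real_inner_self_eq_norm_sq, hξ]
    simp only [steinKernel, hd₁, ← hs, ← hc]
    simp_rw [scalarKernel_eq_inner]
    rw [hd₂ (deriv κ s), hd₂ (κ s)]
    simp only [inner_add_left, inner_add_right, real_inner_smul_left, real_inner_smul_right,
      real_inner_comm (κ s) (deriv κ s)]
    ring
  rw [h1, h2, Real.sqrt_sq (norm_nonneg _)]
  exact abs_real_inner_le_norm _ _

theorem integrable_sqrt {α : Type*} [MeasurableSpace α] {μ : Measure α} [IsFiniteMeasure μ]
    {h : α → ℝ} (hh : Integrable h μ) : Integrable (fun x => √(h x)) μ := by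
  refine ((integrable_const (1 : ℝ)).add hh.norm).mono'
    (Real.continuous_sqrt.comp_aestronglyMeasurable hh.1) (Eventually.of_forall fun x => ?_)
  rw [Real.norm_of_nonneg (Real.sqrt_nonneg _)]
  simp only [Pi.add_apply, Real.norm_eq_abs]
  refine Real.sqrt_le_iff.2 ⟨by positivity, ?_⟩
  nlinarith [le_abs_self (h x), abs_nonneg (h x), sq_nonneg |h x|]

theorem integrable_steinOp (hq : IsDiffPosDensity q)
    (hκ : Differentiable ℝ fun t => RKHS.kerFun H t (1 : ℝ))
    (hfin : Integrable (fun x => steinKernel p r g (scalarKernel H) x x) (densityMeasure q))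
    (f : H) : Integrable (steinOp p r g f) (densityMeasure q) := by
  have := hq.isProbabilityMeasure
  have hf : Continuous f := continuous_iff_continuousAt.2 fun t =>
    (RKHS.hasDerivAt_of_differentiable_kerFun hκ f t).continuousAt
  exact ((integrable_sqrt hfin).mul_const ‖f‖).mono'
    (measurable_steinOp p r g hf).aestronglyMeasurable
    (Eventually.of_forall fun x => abs_steinOp_le hκ p r g f x)

/-- Stein's identity for a function on the line whose ridge function is in the Stein class. -/
theorem integral_steinOp_eq_zero (hq : IsDiffPosDensity q) {f : ℝ → ℝ}
    (hf : Differentiable ℝ f)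
    (h : InSteinClass q fun y => f (inner ℝ y (g : Euc D))) (r : USphere D) :
    ∫ x, steinOp q r g f x ∂(densityMeasure q) = 0 := by
  obtain ⟨-, hint, hzero⟩ := h
  rw [hq.integral_densityMeasure]
  have key : ∀ x, q x * steinOp q r g f x =
      inner ℝ (r : Euc D) (∇ (fun y => f (inner ℝ y (g : Euc D)) * q y) x) := by
    intro x
    have h1 : HasFDerivAt (fun y : Euc D => f (inner ℝ y (g : Euc D)))
        (deriv f (inner ℝ x (g : Euc D)) • innerSL ℝ (g : Euc D)) x := by
      refine (hf _).hasDerivAt.comp_hasFDerivAt x ?_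
      simp_rw [real_inner_comm (g : Euc D)]
      exact (innerSL ℝ (g : Euc D)).hasFDerivAt
    rw [real_inner_comm, gradient, InnerProductSpace.toDual_symm_apply,
      fderiv_fun_mul h1.differentiableAt (hq.differentiable x), h1.fderiv, steinOp, mul_add, ← mul_assoc,
      hq.mul_projScore]
    simp [real_inner_comm (g : Euc D)]
    ring
  simp_rw [key]
  rw [integral_inner hint, hzero, inner_zero_right]

theorem RKHS.integrable_mul_ridge {μ : Measure (Euc D)} {w : Euc D → ℝ} (hw : Integrable w μ)
    (hκ : Differentiable ℝ fun t => RKHS.kerFun H t (1 : ℝ)) {C : ℝ}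
    (hC : ∀ (f : H) t, |f t| ≤ C * ‖f‖) (f : H) :
    Integrable (fun x => w x * f (inner ℝ x (g : Euc D))) μ := by
  have hf : Continuous f := continuous_iff_continuousAt.2 fun t =>
    (RKHS.hasDerivAt_of_differentiable_kerFun hκ f t).continuousAt
  exact hw.mul_bdd (c := C * ‖f‖)
    (hf.comp (by fun_prop : Continuous fun x : Euc D => inner ℝ x (g : Euc D))).aestronglyMeasurable
    (Eventually.of_forall fun x => hC f _)

theorem RKHS.exists_abs_apply_le (g : USphere D)
    (hbdd : BddAbove (Set.range fun x : Euc D =>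
      scalarKernel H (inner ℝ x (g : Euc D)) (inner ℝ x (g : Euc D)))) :
    ∃ C, ∀ (f : H) t, |f t| ≤ C * ‖f‖ := by
  obtain ⟨M, hM⟩ := hbdd
  refine ⟨√M, fun f t => ?_⟩
  have h1 : ‖RKHS.kerFun H t (1 : ℝ)‖ ≤ √M := by
    refine Real.le_sqrt_of_sq_le ?_
    have := hM ⟨t • (g : Euc D), rfl⟩
    simpa [inner_smul_left, scalarKernel_eq_inner, real_inner_self_eq_norm_sq,
      -RKHS.kerFun_inner, -RKHS.inner_kerFun] using this
  rw [RKHS.apply_eq_inner_kerFun f]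
  exact (abs_real_inner_le_norm _ _).trans (by gcongr)

/-- For `f` in the Hilbert space, the expected Stein operator of `p` is the expectation of `f`
against the difference of the scores. -/
theorem integral_steinOp_eq (hq : IsDiffPosDensity q)
    (hs1 : Integrable (fun x => projScore p r x - projScore q r x) (densityMeasure q))
    (hstein : KernelInSteinClass q fun x y =>
      scalarKernel H (inner ℝ x (g : Euc D)) (inner ℝ y (g : Euc D)))
    (hbdd : BddAbove (Set.range fun x : Euc D =>
      scalarKernel H (inner ℝ x (g : Euc D)) (inner ℝ x (g : Euc D))))
    (hfin : Integrable (fun x => steinKernel p r g (scalarKernel H) x x) (densityMeasure q))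
    (f : H) :
    ∫ x, steinOp p r g f x ∂(densityMeasure q) =
      ∫ x, (projScore p r x - projScore q r x) * f (inner ℝ x (g : Euc D))
        ∂(densityMeasure q) := by
  have := hq.isProbabilityMeasure
  have hκ := differentiable_kerFun_of_kernelInSteinClass hstein
  obtain ⟨C, hC⟩ := RKHS.exists_abs_apply_le g hbdd
  have hsub : ∀ (f : H) x, steinOp q r g f x = steinOp p r g f x -
      (projScore p r x - projScore q r x) * f (inner ℝ x (g : Euc D)) := by
    intro f x
    simp only [steinOp]
    ring
  have hint : ∀ f : H, Integrable (steinOp q r g f) (densityMeasure q) := fun f =>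
    ((integrable_steinOp hq hκ hfin f).sub
      (RKHS.integrable_mul_ridge hs1 hκ hC f)).congr
      (Eventually.of_forall fun x => (hsub f x).symm)
  -- The two Stein operators differ by the score difference times `f`, so only Stein's identity for
  -- `q` remains.
  suffices h : ∫ x, steinOp q r g f x ∂(densityMeasure q) = 0 by
    simp_rw [hsub] at h
    rwa [integral_sub (integrable_steinOp hq hκ hfin f)
      (RKHS.integrable_mul_ridge hs1 hκ hC f), sub_eq_zero] at h
  have hdiff : ∀ f : H, Differentiable ℝ f := fun f t =>
    (RKHS.hasDerivAt_of_differentiable_kerFun hκ f t).differentiableAt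
  let L : H →ₗ[ℝ] ℝ :=
    { toFun := fun f => ∫ x, steinOp q r g f x ∂(densityMeasure q)
      map_add' := fun f f' => by
        rw [← integral_add (hint f) (hint f')]
        congr 1 with x
        simp only [steinOp, RKHS.coe_add, Pi.add_apply, deriv_add (hdiff f _) (hdiff f' _)]
        ring
      map_smul' := fun a f => by
        rw [RingHom.id_apply, smul_eq_mul, ← integral_const_mul]
        congr 1 with x
        simp only [steinOp, RKHS.coe_smul, Pi.smul_apply, smul_eq_mul,
          deriv_const_smul a (hdiff f _)]
        ring }
  have hbound : ∀ f : H, ‖L f‖ ≤ (∫ x, (√(steinKernel p r g (scalarKernel H) x x) +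
      |projScore p r x - projScore q r x| * C) ∂(densityMeasure q)) * ‖f‖ := by
    intro f
    rw [← integral_mul_const]
    refine norm_integral_le_of_norm_le
      (((integrable_sqrt hfin).add (hs1.abs.mul_const C)).mul_const _)
      (Eventually.of_forall fun x => ?_)
    rw [hsub, Real.norm_eq_abs]
    refine (abs_sub _ _).trans ?_
    rw [add_mul, abs_mul, mul_assoc]
    exact add_le_add (abs_steinOp_le hκ p r g f x)
      (mul_le_mul_of_nonneg_left (hC f _) (abs_nonneg _))
  let Lc : H →L[ℝ] ℝ := L.mkContinuous _ hbound
  -- The kernel of the bounded functional is closed and contains the kernel sections, whose span is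
  -- dense.
  have hker : Submodule.span ℝ {RKHS.kerFun H x v | (x) (v)} ≤ LinearMap.ker Lc.toLinearMap := by
    refine Submodule.span_le.2 ?_
    rintro _ ⟨t, v, rfl⟩
    have hv : RKHS.kerFun H t v = v • RKHS.kerFun H t (1 : ℝ) := by
      rw [← map_smul, smul_eq_mul, mul_one]
    rw [hv]
    refine Submodule.smul_mem _ _ ?_
    refine integral_steinOp_eq_zero hq (hdiff _) ?_ r
    have := (hstein.2 (t • (g : Euc D))).2
    simpa [inner_smul_left, scalarKernel, RKHS.kerFun_apply] using this
  have htop : LinearMap.ker Lc.toLinearMap = ⊤ := by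
    refine top_unique ?_
    rw [← RKHS.kerFun_dense H]
    exact Submodule.topologicalClosure_minimal _ hker Lc.isClosed_ker
  exact LinearMap.mem_ker.1 (htop.symm ▸ Submodule.mem_top : f ∈ LinearMap.ker Lc.toLinearMap)

end SteinOp

/-! ### Vanishing of the discrepancy. -/

section Discrepancy

variable {p q : Euc D → ℝ} {r g : USphere D} {H : Type*} [NormedAddCommGroup H]
  [InnerProductSpace ℝ H] [CompleteSpace H] [RKHS ℝ H ℝ ℝ]

/-- The discrepancy vanishes exactly when the score difference is orthogonal to all ridge
functions with profile in the Hilbert space. -/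
theorem discSq_eq_zero_iff (hq : IsDiffPosDensity q)
    (hs1 : Integrable (fun x => projScore p r x - projScore q r x) (densityMeasure q))
    (hstein : KernelInSteinClass q fun x y =>
      scalarKernel H (inner ℝ x (g : Euc D)) (inner ℝ y (g : Euc D)))
    (hbdd : BddAbove (Set.range fun x : Euc D =>
      scalarKernel H (inner ℝ x (g : Euc D)) (inner ℝ x (g : Euc D))))
    (hfin : Integrable (fun x => steinKernel p r g (scalarKernel H) x x) (densityMeasure q)) :
    discSq q p r g H = 0 ↔ ∀ f : H,
      ∫ x, (projScore p r x - projScore q r x) * f (inner ℝ x (g : Euc D))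
        ∂(densityMeasure q) = 0 := by
  have := hq.isProbabilityMeasure
  have hκ := differentiable_kerFun_of_kernelInSteinClass hstein
  set v : H → ℝ := fun f =>
    ∫ x, (projScore p r x - projScore q r x) * f (inner ℝ x (g : Euc D)) ∂(densityMeasure q)
    with hv
  have hstep : ∀ f : H, ∫ x, steinOp p r g f x ∂(densityMeasure q) = v f :=
    integral_steinOp_eq hq hs1 hstein hbdd hfin
  have hdisc : discSq q p r g H = (⨆ f : Metric.closedBall (0 : H) 1, v f) ^ 2 := by
    simp_rw [← hstep]
    rfl
  have hsmul : ∀ (a : ℝ) (f : H), v (a • f) = a * v f := by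
    intro a f
    simp only [hv]
    rw [← integral_const_mul]
    congr 1 with x
    simp only [RKHS.coe_smul, Pi.smul_apply, smul_eq_mul]
    ring
  rw [hdisc, sq_eq_zero_iff]
  constructor
  · intro hsup f
    -- Without this bound a zero supremum would say nothing, as the real `⨆` of an unbounded family
    -- is `0` by default.
    have hb : BddAbove (Set.range fun f : Metric.closedBall (0 : H) 1 => v f) := by
      refine ⟨∫ x, √(steinKernel p r g (scalarKernel H) x x) ∂(densityMeasure q), ?_⟩
      rintro _ ⟨f, rfl⟩
      have hf : ‖(f : H)‖ ≤ 1 := mem_closedBall_zero_iff.1 f.2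
      simp only [← hstep]
      refine integral_mono (integrable_steinOp hq hκ hfin _) (integrable_sqrt hfin) fun x => ?_
      exact (le_abs_self _).trans ((abs_steinOp_le hκ p r g _ x).trans
        (mul_le_of_le_one_right (Real.sqrt_nonneg _) hf))
    have hle : ∀ f : H, ‖f‖ ≤ 1 → v f ≤ 0 := fun f hf =>
      (le_ciSup hb ⟨f, mem_closedBall_zero_iff.2 hf⟩).trans_eq hsup
    have hpos : 0 < ‖f‖ + 1 := by positivity
    -- Scaling by `±(‖f‖ + 1)⁻¹` puts `f` and `-f` in the unit ball, even when `f = 0`; both signs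
    -- together give `v f = 0`.
    have hnorm : ∀ a : ℝ, |a| = 1 → ‖(a * (‖f‖ + 1)⁻¹) • f‖ ≤ 1 := by
      intro a ha
      rw [norm_smul, norm_mul, Real.norm_eq_abs a, ha, one_mul, norm_inv,
        Real.norm_of_nonneg hpos.le, inv_mul_le_iff₀ hpos]
      linarith
    have h1 := hle _ (hnorm 1 (by simp))
    have h2 := hle _ (hnorm (-1) (by simp))
    rw [hsmul] at h1 h2
    have hi : 0 < (‖f‖ + 1)⁻¹ := inv_pos.2 hpos
    nlinarith
  · intro h
    exact (iSup_congr fun f : Metric.closedBall (0 : H) 1 => h f).trans Real.iSup_const_zero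

end Discrepancy

/-! ### From vanishing discrepancies to equal densities. -/

/-- A function that is orthogonal to the ridge functions with profile in a dense subset of `C₀`
is orthogonal to all ridge functions with profile in `C₀`. -/
theorem integral_ridge_eq_zero_of_dense {μ : Measure (Euc D)} {w : Euc D → ℝ}
    (hw : Integrable w μ) (g : Euc D) {S : Set C₀(ℝ, ℝ)} (hS : Dense S)
    (h : ∀ F ∈ S, ∫ x, w x * F (inner ℝ x g) ∂μ = 0) (F : C₀(ℝ, ℝ)) :
    ∫ x, w x * F (inner ℝ x g) ∂μ = 0 := by
  have hi : Continuous fun x : Euc D => inner ℝ x g := by fun_prop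
  have hint : ∀ F : C₀(ℝ, ℝ), Integrable (fun x => w x * F (inner ℝ x g)) μ := fun F =>
    hw.mul_bdd (c := ‖F.toBCF‖) ((map_continuous F).comp hi).aestronglyMeasurable
      (Eventually.of_forall fun x => F.toBCF.norm_coe_le_norm _)
  have hc : Continuous fun F : C₀(ℝ, ℝ) => ∫ x, w x * F (inner ℝ x g) ∂μ := by
    refine (LipschitzWith.of_dist_le_mul (K := (∫ x, ‖w x‖ ∂μ).toNNReal)
      fun F F' => ?_).continuous
    rw [Real.coe_toNNReal _ (integral_nonneg fun _ => norm_nonneg _), dist_eq_norm,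
      ← integral_sub (hint F) (hint F'), ← integral_mul_const]
    refine norm_integral_le_of_norm_le (hw.norm.mul_const _) (Eventually.of_forall fun x => ?_)
    rw [← mul_sub, norm_mul, ← dist_eq_norm (F _)]
    exact mul_le_mul_of_nonneg_left
      (BoundedContinuousFunction.dist_coe_le_dist (f := F.toBCF) (g := F'.toBCF) _)
      (norm_nonneg _)
  exact congrFun (Continuous.ext_on hS hc continuous_const fun F hF => h F hF) F

theorem ae_sphereUniform_iff {P : USphere D → Prop} :
    (∀ᵐ g ∂(sphereUniform D), P g) ↔ ∀ᵐ g ∂((volume : Measure (Euc D)).toSphere), P g := by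
  rw [sphereUniform, Measure.ae_ennreal_smul_measure_iff (ENNReal.inv_ne_zero.2 (measure_ne_top _ _))]

/-- Two differentiable positive densities with almost everywhere equal scores are equal. -/
theorem IsDiffPosDensity.eq_of_fderiv_log_ae_eq {p q : Euc D → ℝ} (hp : IsDiffPosDensity p)
    (hq : IsDiffPosDensity q)
    (h : ∀ᵐ x, fderiv ℝ (fun y => Real.log (p y)) x = fderiv ℝ (fun y => Real.log (q y)) x) :
    p = q := by
  have hconst := eq_of_fderiv_ae_eq_zero volume
    (hp.differentiable_log.sub hq.differentiable_log) (h.mono fun x hx => by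
      rw [fderiv_sub (hp.differentiable_log x) (hq.differentiable_log x), hx, sub_self])
  have hmul : ∀ x, p x = Real.exp (Real.log (p 0) - Real.log (q 0)) * q x := by
    intro x
    have := hconst x 0
    simp only [Pi.sub_apply] at this
    rw [← this, Real.exp_sub, Real.exp_log (hp.pos x), Real.exp_log (hq.pos x),
      div_mul_cancel₀ _ (hq.pos x).ne']
  have hone := hp.integral_eq_one
  rw [show p = fun x => _ from funext hmul, integral_const_mul, hq.integral_eq_one, mul_one] at hone
  funext x
  rw [hmul, hone, one_mul]

theorem theorem3 {D : ℕ} (p q : Euc D → ℝ)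
    -- an RKHS of functions on the line for every pair of directions
    (H : USphere D → USphere D → Type*) [∀ r g, NormedAddCommGroup (H r g)]
    [∀ r g, InnerProductSpace ℝ (H r g)] [∀ r g, CompleteSpace (H r g)]
    [∀ r g, RKHS ℝ (H r g) ℝ ℝ]
    (O : OrthonormalBasis (Fin D) ℝ (Euc D))
    -- the densities
    (hp : IsDiffPosDensity p) (hq : IsDiffPosDensity q)
    (hq0 : Tendsto q (cocompact (Euc D)) (𝓝 0))
    -- the score difference is in `L¹(q)` and in `L²(q)`
    (hs1 : ∀ r : USphere D, Integrable (fun x => projScore p r x - projScore q r x)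
      (densityMeasure q))
    (hs2 : ∀ r : USphere D, Integrable (fun x => (projScore p r x - projScore q r x) ^ 2)
      (densityMeasure q))
    -- the kernels
    (huniv : ∀ r g, IsC0Universal (H r g))
    (hstein : ∀ r g : USphere D, KernelInSteinClass q (fun x y =>
      scalarKernel (H r g) (inner ℝ x (g : Euc D)) (inner ℝ y (g : Euc D))))
    (hbdd : ∀ r g : USphere D, BddAbove (Set.range fun x : Euc D =>
      scalarKernel (H r g) (inner ℝ x (g : Euc D)) (inner ℝ x (g : Euc D))))
    -- finiteness of `E_q[h_{p,r,g}(x, x)]`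
    (hfin : ∀ r g : USphere D, Integrable (fun x => steinKernel p r g (scalarKernel (H r g)) x x)
      (densityMeasure q))
    -- the integral over `g` makes sense
    (hmeas : ∀ i, AEMeasurable (fun g => discSq q p (basisDir O i) g (H (basisDir O i) g))
      (sphereUniform D)) :
    SKo O q p H = 0 ↔ p =ᵐ[volume] q := by
  have hdisc : ∀ r g, discSq q p r g (H r g) = 0 ↔ _ := fun r g =>
    discSq_eq_zero_iff hq (hs1 r) (hstein r g) (hbdd r g) (hfin r g)
  constructor
  · intro h
    refine Eventually.of_forall (congrFun (hp.eq_of_fderiv_log_ae_eq hq ?_))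
    have hdir : ∀ i, ∀ᵐ x, projScore p (basisDir O i) x = projScore q (basisDir O i) x := by
      intro i
      have hi : ∫⁻ g, ENNReal.ofReal (discSq q p (basisDir O i) g (H (basisDir O i) g))
          ∂(sphereUniform D) = 0 := Finset.sum_eq_zero_iff.1 h i (Finset.mem_univ i)
      rw [lintegral_eq_zero_iff' (hmeas i).ennreal_ofReal] at hi
      -- Surface measure charges every nonempty open set, so a set of full measure is dense.
      have hG := Measure.dense_of_ae (ae_sphereUniform_iff.1 hi)
      have := hq.isProbabilityMeasure
      have : Nonempty (USphere D) := ⟨basisDir O i⟩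
      have hφ := ae_eq_zero_of_integral_ridge_eq_zero (densityMeasure q) (hs1 (basisDir O i)) hG
        fun g hg => integral_ridge_eq_zero_of_dense (hs1 _) _ (huniv (basisDir O i) g).2 ?_
      · rw [EventuallyEq, hq.ae_densityMeasure] at hφ
        exact hφ.mono fun x hx => sub_eq_zero.1 hx
      · rintro F ⟨f, hf⟩
        -- `discSq` is a square, so truncation by `ENNReal.ofReal` loses nothing.
        have h0 : discSq q p (basisDir O i) g (H (basisDir O i) g) = 0 :=
          le_antisymm (ENNReal.ofReal_eq_zero.1 hg) (sq_nonneg _)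
        simp_rw [hf]
        exact (hdisc _ g).1 h0 f
    filter_upwards [ae_all_iff.2 hdir] with x hx
    refine ContinuousLinearMap.coe_injective (O.toBasis.ext fun i => ?_)
    simpa [projScore_eq_fderiv_log, basisDir] using hx i
  · intro h
    -- Continuity upgrades almost everywhere equality to equality, so that the scores agree too.
    obtain rfl : p = q :=
      (hp.differentiable.continuous.ae_eq_iff_eq volume hq.differentiable.continuous).1 h
    have h0 : ∀ r g, discSq p p r g (H r g) = 0 := fun r g => (hdisc r g).2 fun f => by simp
    simp [SKo, h0]
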